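/- Tile the plane by the closed unit equilateral triangles of the triangular lattice. A polyiamond is a nonempty finite set \(A\) of these triangles (tiles) glued together along edges, that is, the dual graph whose vertices are the tiles of \(A\), two tiles being joined when they share an edge, is connected. Identify \(A\) with the union of its closed tiles. Its number of holes is the number of bounded connected components of the complement of \(A\) in the plane. Its perimeter is the number of edges of its tiles that lie on the topological boundary of \(A\), and an interior edge of \(A\) is an edge shared by two of its tiles. For \(n\ge 1\) let \(p_{\min}(n)\) and \(b_{\min}(n)\) be the minimum perimeter and the minimum number of interior edges of a polyiamond with \(n\) tiles. Let \(g_\triangle(h)\) be the minimum number of tiles of a polyiamond with \(h\) holes, and for \(n\ge 1\), \(h\ge 0\) put \[M(n,h)=\frac{3n-2b_{\min}(n)-p_{\min}(n+h)}{3}.\] Then: 1. If there exists a polyiamond with \(n\) tiles and \(h\) holes, then \[h\le \frac{3n-2b_{\min}(n)-p_{\min}(n+h)}{3}.\] 2. For all \(n\ge 1\) and \(h\ge 0\), \[M(n,h)=\frac{n+2-p_{\min}(n+h)}{3}.\] 3. If \(M(n,h)<h\), then there is no polyiamond with \(n\) tiles and \(h\) holes. 4. If there exists a polyiamond with \(n\)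 tiles and \(h\) holes, where \(n=\min\{m\ge 1 : M(m,h)=h\}\), then \(g_\triangle(h)=n\). -/

import Mathlib

namespace Polyiamond

/-- The vertices of the triangular lattice, in the basis `1`, `exp (π i / 3)` of the plane `ℂ`. -/
abbrev LatticePoint := ℤ × ℤ

/-- The position in the plane of a vertex: the pair `(a, b)` stands for `a + b (1/2 + (√3/2) i)`. -/
noncomputable def pos (v : LatticePoint) : ℂ :=
  ⟨(v.1 : ℝ) + (v.2 : ℝ) / 2, Real.sqrt 3 / 2 * (v.2 : ℝ)⟩

/-- The unit triangles of the triangular lattice: `up a b` has its horizontal edge at the base,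
`down a b` has its horizontal edge on top, and both lie in the unit rhombus with lower left
corner `(a, b)`. -/
inductive Tile : Type
  | up (a b : ℤ) : Tile
  | down (a b : ℤ) : Tile
  deriving DecidableEq

/-- The three vertices of a tile. -/
def Tile.vertices : Tile → Finset LatticePoint
  | .up a b => {(a, b), (a + 1, b), (a, b + 1)}
  | .down a b => {(a + 1, b), (a, b + 1), (a + 1, b + 1)}

/-- The three edges of a tile, each given by its two endpoints. -/
def Tile.edges (t : Tile) : Finset (Finset LatticePoint) :=
  t.vertices.powersetCard 2

/-- The closed convex subset of the plane spanned by a finite set of vertices: a closed segment for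
an edge, a closed equilateral triangle for the vertices of a tile. -/
def hull (s : Finset LatticePoint) : Set ℂ :=
  convexHull ℝ (pos '' (s : Set LatticePoint))

/-- The planar shape covered by a finite set of tiles: the union of the closed triangles. -/
def region (A : Finset Tile) : Set ℂ :=
  ⋃ t ∈ A, hull t.vertices

/-- Two different tiles are adjacent if they have a common edge. -/
def tileGraph : SimpleGraph Tile where
  Adj s t := s ≠ t ∧ ∃ e, e ∈ s.edges ∧ e ∈ t.edges
  symm := ⟨fun _ _ h => ⟨h.1.symm, h.2.imp fun _ he => ⟨he.2, he.1⟩⟩⟩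
  loopless := ⟨fun _ h => h.1 rfl⟩

/-- A finite set of tiles is a polyiamond if its tiles are glued together along edges, i.e. if its
dual graph is connected (in particular it has at least one tile). -/
def IsPolyiamond (A : Finset Tile) : Prop :=
  (tileGraph.induce (A : Set Tile)).Connected

/-- The number of holes: the number of bounded connected components of the complement of the shape
in the plane. -/
noncomputable def holes (A : Finset Tile) : ℕ :=
  {C : Set ℂ | (∃ x ∈ (region A)ᶜ, C = connectedComponentIn (region A)ᶜ x) ∧
    Bornology.IsBounded C}.ncard

/-- The perimeter: the number of edges that are on the topological boundary of the shape. -/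
noncomputable def perimeter (A : Finset Tile) : ℕ :=
  {e : Finset LatticePoint | (∃ t ∈ A, e ∈ t.edges) ∧ hull e ⊆ frontier (region A)}.ncard

/-- The number of interior edges: the edges which are on the boundary of two tiles. -/
noncomputable def interiorEdges (A : Finset Tile) : ℕ :=
  {e : Finset LatticePoint | ∃ s ∈ A, ∃ t ∈ A, s ≠ t ∧ e ∈ s.edges ∧ e ∈ t.edges}.ncard

/-- The minimum perimeter of a polyiamond with `n` tiles (meaningful for `n ≥ 1`). -/
noncomputable def pMin (n : ℕ) : ℕ :=
  sInf {p | ∃ A : Finset Tile, IsPolyiamond A ∧ A.card = n ∧ perimeter A = p}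

/-- The minimum number of interior edges of a polyiamond with `n` tiles (meaningful for
`n ≥ 1`). -/
noncomputable def bMin (n : ℕ) : ℕ :=
  sInf {b | ∃ A : Finset Tile, IsPolyiamond A ∧ A.card = n ∧ interiorEdges A = b}

/-- The minimum number of tiles of a polyiamond with `h` holes. -/
noncomputable def gTri (h : ℕ) : ℕ :=
  sInf {n | ∃ A : Finset Tile, IsPolyiamond A ∧ holes A = h ∧ A.card = n}

/-- The bound `M(n, h) = (3 n - 2 b_min(n) - p_min(n + h)) / 3`, a rational number. -/
noncomputable def M (n h : ℕ) : ℚ :=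
  (3 * (n : ℚ) - 2 * (bMin n : ℚ) - (pMin (n + h) : ℚ)) / 3

end Polyiamond

/-!
In the adjacency graph of the tiles every tile has three neighbours, so the perimeter of a set `A`
of tiles is its edge boundary `cut A`, the number of pairs of adjacent tiles with the first in `A`
and the second outside (`perimeter_eq_cut`). It satisfies `cut A + 2 * interiorEdges A = 3 * #A`. A
polyiamond with `n` tiles has at least `n - 1` interior edges, with equality for a strip, hence
`bMin n = n - 1` and `cut A ≤ n + 2`.

Let `A` be a polyiamond with `n` tiles and holes `C₁, …, Cₕ`. The tiles whose interior lies in `Cᵢ`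
form a nonempty finite set `Tᵢ`; different `Tᵢ` are disjoint, and the neighbours of `Tᵢ` outside `Tᵢ`
all belong to `A`. Filling the holes therefore gives a set of `n + ∑ #Tᵢ` tiles with edge boundary
`cut A - ∑ cut Tᵢ` (`exists_fill`). A single tile has boundary three, and a larger set has at least
four.

If all holes are single tiles, then `minCut (n + h) ≤ n + 2 - 3 * h`, where `minCut k` is the least
boundary of a set of `k` tiles. Otherwise the filled set is larger than `n + h`, but one more unit of
boundary has been saved. This suffices because `minCut m ≤ minCut k + 1` whenever `1 ≤ m ≤ k`
(`minCut_le_add_one_of_le`): in the top row of any set there is either a leaf of the adjacency graph,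
or a pair of adjacent corner tiles with at most two neighbours each (`exists_leaf_or_flat_corner`),
so one tile can be removed at the cost of one unit of boundary, and two tiles at no cost.

Finally `minCut` agrees with `pMin`, although it disregards connectedness: two sets can be glued
along an edge so that their total boundary drops (`minCut_add_add_two_le`), hence a disconnected set
never has the least boundary for its size (`isPolyiamond_of_cut_eq_minCut`).
-/

namespace Polyiamond

open Finset

/-! ### The edge boundary of a set of tiles -/

/-- The three tiles that share an edge with a given tile. -/
def Tile.nbrs : Tile → Finset Tile
  | .up a b => {.down a b, .down (a - 1) b, .down a (b - 1)}
  | .down a b => {.up a b, .up (a + 1) b, .up a (b + 1)}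

/-- The index of the horizontal strip that contains a tile. -/
def Tile.row : Tile → ℤ
  | .up _ b => b
  | .down _ b => b

/-- The position of a tile in its horizontal strip, counted from left to right: upward and downward
tiles alternate. -/
def Tile.col : Tile → ℤ
  | .up a _ => 2 * a
  | .down a _ => 2 * a + 1

theorem Tile.card_nbrs (t : Tile) : #t.nbrs = 3 := by
  cases t <;> exact Finset.card_eq_three.2
    ⟨_, _, _, by simp; try omega, by simp; try omega, by simp; try omega, rfl⟩

theorem Tile.mem_nbrs_comm {s t : Tile} : s ∈ t.nbrs ↔ t ∈ s.nbrs := by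
  cases s <;> cases t <;> simp [Tile.nbrs] <;> omega

theorem Tile.notMem_nbrs_self (t : Tile) : t ∉ t.nbrs := by
  cases t <;> simp [Tile.nbrs]

/-- The adjacency graph of the tiles is bipartite, so it has no triangle. -/
theorem Tile.nbrs_inter_nbrs_eq_empty {s t : Tile} (h : s ∈ t.nbrs) : s.nbrs ∩ t.nbrs = ∅ := by
  ext r
  cases s <;> cases t <;> cases r <;> simp [Tile.nbrs] at h ⊢

/-- The size of the edge boundary of a set of tiles in the adjacency graph: the number of pairs of
adjacent tiles of which the first belongs to the set and the second does not. -/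
def cut (A : Finset Tile) : ℕ := ∑ t ∈ A, #(t.nbrs \ A)

theorem sum_card_nbrs_inter_comm (S T : Finset Tile) :
    ∑ t ∈ S, #(t.nbrs ∩ T) = ∑ t ∈ T, #(t.nbrs ∩ S) := by
  have h := Finset.sum_card_bipartiteAbove_eq_sum_card_bipartiteBelow
    (s := S) (t := T) (fun s t => t ∈ s.nbrs)
  convert h using 2 with t _ t _
  · congr 1; ext r; simp [Finset.bipartiteAbove, and_comm]
  · congr 1; ext r; simp [Finset.bipartiteBelow, and_comm, Tile.mem_nbrs_comm]

/-- Joining two disjoint sets of tiles removes each edge between them from both boundaries. -/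
theorem cut_union {S T : Finset Tile} (h : Disjoint S T) :
    cut (S ∪ T) + 2 * ∑ t ∈ T, #(t.nbrs ∩ S) = cut S + cut T := by
  have key : ∀ S T : Finset Tile, Disjoint S T →
      cut S = ∑ t ∈ S, #(t.nbrs \ (S ∪ T)) + ∑ t ∈ S, #(t.nbrs ∩ T) := by
    intro S T h
    rw [cut, ← Finset.sum_add_distrib]
    refine Finset.sum_congr rfl fun t _ => ?_
    rw [← Finset.card_union_of_disjoint]
    · congr 1
      ext r
      have := fun hr : r ∈ _ => Finset.disjoint_left.1 h hr
      simp only [Finset.mem_sdiff, Finset.mem_union, Finset.mem_inter]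
      tauto
    · rw [Finset.disjoint_left]
      simp only [Finset.mem_sdiff, Finset.mem_union, Finset.mem_inter]
      tauto
  rw [key S T h, key T S h.symm, sum_card_nbrs_inter_comm S T, cut, Finset.sum_union h,
    Finset.union_comm T S]
  ring

theorem cut_singleton (t : Tile) : cut {t} = 3 := by
  rw [cut, Finset.sum_singleton, Finset.sdiff_singleton_eq_erase,
    Finset.erase_eq_of_notMem t.notMem_nbrs_self, t.card_nbrs]

theorem cut_insert {t : Tile} {A : Finset Tile} (h : t ∉ A) :
    cut (insert t A) + 2 * #(t.nbrs ∩ A) = cut A + 3 := by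
  have := cut_union (S := A) (T := {t}) (by simpa using h)
  rwa [Finset.union_comm, ← Finset.insert_eq, Finset.sum_singleton, cut_singleton] at this

theorem nbrs_inter_erase (t : Tile) (A : Finset Tile) : t.nbrs ∩ A.erase t = t.nbrs ∩ A := by
  ext r
  have := t.notMem_nbrs_self
  by_cases h : r = t
  · subst h; simp [this]
  · simp [h]

theorem cut_erase {t : Tile} {A : Finset Tile} (h : t ∈ A) :
    cut A + 2 * #(t.nbrs ∩ A) = cut (A.erase t) + 3 := by
  have := cut_insert (Finset.notMem_erase t A)
  rwa [Finset.insert_erase h, nbrs_inter_erase] at this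

/-- Filling a set of tiles all of whose outer neighbours are present removes its boundary. -/
theorem cut_union_of_closed {A T : Finset Tile} (h : Disjoint A T)
    (hT : ∀ t ∈ T, ∀ s ∈ t.nbrs, s ∉ T → s ∈ A) : cut (A ∪ T) + cut T = cut A := by
  have h1 := cut_union h
  have h2 : cut T = ∑ t ∈ T, #(t.nbrs ∩ A) := by
    refine Finset.sum_congr rfl fun t ht => ?_
    congr 1
    ext r
    have := fun hr : r ∈ _ => Finset.disjoint_left.1 h hr
    have := hT t ht r
    simp only [Finset.mem_sdiff, Finset.mem_inter]
    tauto
  omega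

theorem cut_map (f : Tile ≃ Tile) (hf : ∀ t, (f t).nbrs = t.nbrs.map f.toEmbedding)
    (A : Finset Tile) : cut (A.map f.toEmbedding) = cut A := by
  rw [cut, Finset.sum_map]
  refine Finset.sum_congr rfl fun t _ => ?_
  simp only [Equiv.coe_toEmbedding]
  rw [hf, ← Finset.map_sdiff, Finset.card_map]

/-- A point reflection of the lattice. -/
def Tile.reflect (c d : ℤ) : Tile ≃ Tile where
  toFun
    | .up a b => .down (c - a) (d - b)
    | .down a b => .up (c - a) (d - b)
  invFun
    | .up a b => .down (c - a) (d - b)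
    | .down a b => .up (c - a) (d - b)
  left_inv t := by cases t <;> simp
  right_inv t := by cases t <;> simp

theorem Tile.nbrs_reflect (c d : ℤ) (t : Tile) :
    (Tile.reflect c d t).nbrs = t.nbrs.map (Tile.reflect c d).toEmbedding := by
  ext r
  cases t <;> cases r <;> simp [Tile.nbrs, Tile.reflect] <;> omega

theorem Tile.row_reflect (c d : ℤ) (t : Tile) : (Tile.reflect c d t).row = d - t.row := by
  cases t <;> rfl

/-! ### Corners of a set of tiles -/

/-- The rightmost tile of the top row of a set of tiles has at most one neighbour in the set, unless
it points upward and has its left neighbour in the set; then the left neighbour has a free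
horizontal edge on the top line. -/
theorem exists_leaf_or_flat_corner {A : Finset Tile} (hA : A.Nonempty) :
    (∃ t ∈ A, #(t.nbrs ∩ A) ≤ 1) ∨
      ∃ a b, Tile.up (a + 1) b ∈ A ∧ Tile.down a b ∈ A ∧
        #((Tile.up (a + 1) b).nbrs ∩ A) ≤ 2 ∧ #((Tile.down a b).nbrs ∩ A) ≤ 2 ∧
        ∀ s ∈ A, s.row ≤ b := by
  obtain ⟨t₀, ht₀, hmax₀⟩ := A.exists_max_image Tile.row hA
  obtain ⟨t, ht, hmax⟩ := (A.filter fun s => s.row = t₀.row).exists_max_image Tile.col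
    ⟨t₀, by simp [ht₀]⟩
  simp only [Finset.mem_filter] at ht hmax
  obtain ⟨htA, htr⟩ := ht
  rw [← htr] at hmax₀ hmax
  have card_two : ∀ (s : Finset Tile) (x y : Tile), s ⊆ {x, y} → #s ≤ 2 :=
    fun s x y h => (Finset.card_le_card h).trans Finset.card_le_two
  cases t with
  | up a b =>
    have hr : Tile.down a b ∉ A := fun h => by
      have := hmax _ ⟨h, rfl⟩
      simp [Tile.col] at this
    by_cases hl : Tile.down (a - 1) b ∈ A
    · right
      refine ⟨a - 1, b, by simpa using htA, hl, ?_, ?_, hmax₀⟩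
      · refine card_two _ (.down (a - 1) b) (.down a (b - 1)) fun r h => ?_
        simp only [sub_add_cancel, Tile.nbrs, Finset.mem_inter, Finset.mem_insert,
          Finset.mem_singleton] at h ⊢
        rcases h with ⟨rfl | rfl | rfl, h⟩ <;> simp_all
      · have ht : Tile.up (a - 1) (b + 1) ∉ A := fun h => by
          have := hmax₀ _ h
          simp [Tile.row] at this
        refine card_two _ (.up (a - 1) b) (.up (a - 1 + 1) b) fun r h => ?_
        simp only [Tile.nbrs, Finset.mem_inter, Finset.mem_insert,
          Finset.mem_singleton] at h ⊢
        rcases h with ⟨rfl | rfl | rfl, h⟩ <;> simp_all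
    · left
      refine ⟨_, htA, (Finset.card_le_card (t := {Tile.down a (b - 1)}) fun r h => ?_).trans
        (Finset.card_singleton _).le⟩
      simp only [Tile.nbrs, Finset.mem_inter, Finset.mem_insert, Finset.mem_singleton] at h ⊢
      rcases h with ⟨rfl | rfl | rfl, h⟩ <;> simp_all
  | down a b =>
    have hr : Tile.up (a + 1) b ∉ A := fun h => by
      have := hmax _ ⟨h, rfl⟩
      simp [Tile.col] at this
      omega
    have ht : Tile.up a (b + 1) ∉ A := fun h => by
      have := hmax₀ _ h
      simp [Tile.row] at this
    left
    refine ⟨_, htA, (Finset.card_le_card (t := {Tile.up a b}) fun r h => ?_).trans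
      (Finset.card_singleton _).le⟩
    simp only [Tile.nbrs, Finset.mem_inter, Finset.mem_insert, Finset.mem_singleton] at h ⊢
    rcases h with ⟨rfl | rfl | rfl, h⟩ <;> simp_all

theorem exists_card_nbrs_inter_le_two {A : Finset Tile} (hA : A.Nonempty) :
    ∃ t ∈ A, #(t.nbrs ∩ A) ≤ 2 := by
  obtain ⟨t, ht, h⟩ | ⟨a, b, h1, -, h2, -, -⟩ := exists_leaf_or_flat_corner hA
  · exact ⟨t, ht, h.trans one_le_two⟩
  · exact ⟨_, h1, h2⟩

theorem exists_nbr_notMem {A : Finset Tile} (hA : A.Nonempty) :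
    ∃ t ∈ A, ∃ s ∈ t.nbrs, s ∉ A := by
  obtain ⟨t, ht, h⟩ := exists_card_nbrs_inter_le_two hA
  refine ⟨t, ht, ?_⟩
  by_contra! hs
  rw [Finset.inter_eq_left.2 hs, t.card_nbrs] at h
  omega

/-! ### The least boundary of a set of given size -/

/-- The least boundary size of a set of `n` tiles, connected or not. -/
noncomputable def minCut (n : ℕ) : ℕ := sInf {p | ∃ A : Finset Tile, #A = n ∧ cut A = p}

theorem minCut_le (A : Finset Tile) : minCut #A ≤ cut A := Nat.sInf_le ⟨A, rfl, rfl⟩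

theorem exists_card_eq (n : ℕ) : ∃ A : Finset Tile, #A = n :=
  ⟨(Finset.range n).map ⟨fun i : ℕ => Tile.up i 0, fun i j h => by simpa using h⟩, by simp⟩

theorem exists_cut_eq_minCut (n : ℕ) : ∃ A : Finset Tile, #A = n ∧ cut A = minCut n := by
  obtain ⟨A, hA⟩ := exists_card_eq n
  exact Nat.sInf_mem (s := {p | ∃ A : Finset Tile, #A = n ∧ cut A = p}) ⟨_, A, hA, rfl⟩

theorem minCut_one : minCut 1 = 3 := by
  obtain ⟨A, hA, h⟩ := exists_cut_eq_minCut 1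
  obtain ⟨t, rfl⟩ := Finset.card_eq_one.1 hA
  rw [← h, cut_singleton]

theorem minCut_succ_le {n : ℕ} (hn : 1 ≤ n) : minCut (n + 1) ≤ minCut n + 1 := by
  obtain ⟨A, rfl, h⟩ := exists_cut_eq_minCut n
  obtain ⟨t, ht, s, hs, hsA⟩ := exists_nbr_notMem (Finset.card_pos.1 hn)
  have h1 := cut_insert hsA
  have h2 : 1 ≤ #(s.nbrs ∩ A) :=
    Finset.card_pos.2 ⟨t, Finset.mem_inter.2 ⟨Tile.mem_nbrs_comm.1 hs, ht⟩⟩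
  have h3 := minCut_le (insert s A)
  rw [Finset.card_insert_of_notMem hsA] at h3
  omega

theorem minCut_le_succ (n : ℕ) : minCut n ≤ minCut (n + 1) + 1 := by
  obtain ⟨A, hA, h⟩ := exists_cut_eq_minCut (n + 1)
  obtain ⟨t, ht, h2⟩ := exists_card_nbrs_inter_le_two (A := A) (Finset.card_pos.1 (by omega))
  have h1 := cut_erase ht
  have h3 := minCut_le (A.erase t)
  rw [Finset.card_erase_of_mem ht, hA, Nat.add_sub_cancel] at h3
  omega

/-- A leaf and a further corner tile, or the two tiles of a flat corner, can be removed without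
increasing the boundary. -/
theorem minCut_le_add_two {n : ℕ} (hn : 1 ≤ n) : minCut n ≤ minCut (n + 2) := by
  obtain ⟨A, hA, h⟩ := exists_cut_eq_minCut (n + 2)
  obtain ⟨s, hs, t, ht, hd⟩ : ∃ s ∈ A, ∃ t ∈ A.erase s,
      #(s.nbrs ∩ A) + #(t.nbrs ∩ A.erase s) ≤ 3 := by
    obtain ⟨t, ht, h1⟩ | ⟨a, b, hu, hd, hu2, hd2, -⟩ :=
      exists_leaf_or_flat_corner (A := A) (Finset.card_pos.1 (by omega))
    · obtain ⟨s, hs, h2⟩ := exists_card_nbrs_inter_le_two (A := A.erase t)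
        (Finset.card_pos.1 (by rw [Finset.card_erase_of_mem ht]; omega))
      exact ⟨t, ht, s, hs, by omega⟩
    · refine ⟨_, hu, .down a b, by simpa using hd, ?_⟩
      have : #((Tile.down a b).nbrs ∩ A.erase (.up (a + 1) b)) < #((Tile.down a b).nbrs ∩ A) := by
        refine Finset.card_lt_card (Finset.ssubset_iff_subset_ne.2
          ⟨Finset.inter_subset_inter_left (Finset.erase_subset _ _), fun h => ?_⟩)
        have : Tile.up (a + 1) b ∈ (Tile.down a b).nbrs ∩ A := by simp [Tile.nbrs, hu]
        rw [← h] at this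
        simp at this
      omega
  have h1 := cut_erase hs
  have h2 := cut_erase ht
  have h3 := minCut_le ((A.erase s).erase t)
  rw [Finset.card_erase_of_mem ht, Finset.card_erase_of_mem hs, hA,
    show n + 2 - 1 - 1 = n by omega] at h3
  omega

/-- Although `minCut` is not monotone, it never drops by more than one below an earlier value. -/
theorem minCut_le_add_one_of_le {m n : ℕ} (hm : 1 ≤ m) (hmn : m ≤ n) :
    minCut m ≤ minCut n + 1 := by
  obtain ⟨k, rfl⟩ := Nat.exists_eq_add_of_le hmn
  clear hmn
  induction k using Nat.strong_induction_on generalizing m with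
  | _ k ih =>
    match k, ih with
    | 0, _ => simp
    | 1, _ => exact minCut_le_succ m
    | k + 2, ih =>
      have := ih k (by omega) (show 1 ≤ m + 2 by omega)
      rw [show m + 2 + k = m + (k + 2) by ring] at this
      exact (minCut_le_add_two hm).trans this

theorem four_le_minCut {n : ℕ} (hn : 2 ≤ n) : 4 ≤ minCut n := by
  have two : ∀ A : Finset Tile, #A = 2 → 4 ≤ cut A := by
    intro A hA
    obtain ⟨t, ht⟩ := Finset.card_pos.1 (by omega : 0 < #A)
    have h1 := cut_erase ht
    obtain ⟨s, hs⟩ := Finset.card_eq_one.1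
      (show #(A.erase t) = 1 by rw [Finset.card_erase_of_mem ht, hA])
    have h2 : #(t.nbrs ∩ A) ≤ 1 := by
      rw [← nbrs_inter_erase, hs]
      exact (Finset.card_le_card Finset.inter_subset_right).trans (Finset.card_singleton _).le
    rw [hs, cut_singleton] at h1
    omega
  induction n using Nat.strong_induction_on with
  | _ n ih =>
    match n, hn with
    | 2, _ =>
      obtain ⟨A, hA, h⟩ := exists_cut_eq_minCut 2
      exact h ▸ two A hA
    | 3, _ =>
      obtain ⟨A, hA, h⟩ := exists_cut_eq_minCut 3
      -- Among three tiles some tile has at most one neighbour, for there are no triangles.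
      obtain ⟨t, ht, hd⟩ : ∃ t ∈ A, #(t.nbrs ∩ A) ≤ 1 := by
        obtain h | ⟨a, b, hu, hd, -, -, -⟩ :=
          exists_leaf_or_flat_corner (A := A) (Finset.card_pos.1 (by omega))
        · exact h
        · obtain ⟨r, hr⟩ := Finset.card_eq_one.1
            (show #((A.erase (.up (a + 1) b)).erase (.down a b)) = 1 by
              rw [Finset.card_erase_of_mem (by simpa using hd), Finset.card_erase_of_mem hu, hA])
          have hr' : r ∈ (A.erase (.up (a + 1) b)).erase (.down a b) := by simp [hr]
          simp only [Finset.mem_erase] at hr'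
          have hAr : A = {r, .up (a + 1) b, .down a b} := by
            have : A = insert (.up (a + 1) b) (insert (.down a b)
                ((A.erase (.up (a + 1) b)).erase (.down a b))) := by
              rw [Finset.insert_erase (by simpa using hd), Finset.insert_erase hu]
            rw [this, hr]
            ext s
            simp only [Finset.mem_insert, Finset.mem_singleton]
            tauto
          refine ⟨r, hr'.2.2, ?_⟩
          by_cases hru : r ∈ (Tile.up (a + 1) b).nbrs
          · refine (Finset.card_le_card (t := {Tile.up (a + 1) b}) ?_).trans
              (Finset.card_singleton _).le
            intro s hs
            rw [hAr] at hs
            simp only [Finset.mem_inter, Finset.mem_insert, Finset.mem_singleton] at hs ⊢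
            rcases hs with ⟨h1, rfl | rfl | rfl⟩
            · exact absurd h1 (Tile.notMem_nbrs_self _)
            · rfl
            · have := Tile.nbrs_inter_nbrs_eq_empty hru
              have h3 : Tile.down a b ∈ r.nbrs ∩ (Tile.up (a + 1) b).nbrs :=
                Finset.mem_inter.2 ⟨h1, by simp [Tile.nbrs]⟩
              simp [this] at h3
          · refine (Finset.card_le_card (t := {Tile.down a b}) ?_).trans
              (Finset.card_singleton _).le
            intro s hs
            rw [hAr] at hs
            simp only [Finset.mem_inter, Finset.mem_insert, Finset.mem_singleton] at hs ⊢
            rcases hs with ⟨h1, rfl | rfl | rfl⟩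
            · exact absurd h1 (Tile.notMem_nbrs_self _)
            · exact absurd (Tile.mem_nbrs_comm.1 h1) hru
            · rfl
      have h1 := cut_erase ht
      have h2 := two (A.erase t) (by rw [Finset.card_erase_of_mem ht, hA])
      omega
    | n + 4, _ => exact (ih (n + 2) (by omega) (by omega)).trans (minCut_le_add_two (by omega))

theorem three_le_cut {A : Finset Tile} (hA : A.Nonempty) : 3 ≤ cut A := by
  have h := minCut_le A
  obtain h1 | h1 : #A = 1 ∨ 2 ≤ #A := by have := hA.card_pos; omega
  · rwa [h1, minCut_one] at h
  · have := four_le_minCut h1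
    omega

/-- Two optimal sets can be glued along an edge. If one of them has a leaf, the leaf is set aside and
attached again at the end; otherwise both have a flat corner, and a point reflection puts the flat
edge of one on the flat edge of the other. -/
theorem minCut_add_add_two_le {m n : ℕ} (hm : 1 ≤ m) (hn : 1 ≤ n) :
    minCut (m + n) + 2 ≤ minCut m + minCut n := by
  induction hk : m + n using Nat.strong_induction_on generalizing m n with
  | _ k ih =>
    subst hk
    obtain ⟨X, hX, hXc⟩ := exists_cut_eq_minCut m
    obtain ⟨Y, hY, hYc⟩ := exists_cut_eq_minCut n
    have leaf : ∀ {m n : ℕ}, 1 ≤ m → 1 ≤ n →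
        (∀ k < m + n, ∀ {m n : ℕ}, 1 ≤ m → 1 ≤ n → m + n = k →
          minCut k + 2 ≤ minCut m + minCut n) →
        ∀ X : Finset Tile, #X = m → cut X = minCut m → (∃ t ∈ X, #(t.nbrs ∩ X) ≤ 1) →
        minCut (m + n) + 2 ≤ minCut m + minCut n := by
      rintro m n hm hn ih X hX hXc ⟨t, ht, hd⟩
      obtain rfl | hm1 := hm.eq_or_lt
      · have := minCut_succ_le hn
        rw [minCut_one, add_comm 1 n]
        omega
      · have h1 := ih (m - 1 + n) (by omega) (m := m - 1) (by omega) hn rfl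
        have h2 := minCut_succ_le (n := m - 1 + n) (by omega)
        rw [show m - 1 + n + 1 = m + n by omega] at h2
        have h3 := cut_erase ht
        have h4 := minCut_le (X.erase t)
        rw [Finset.card_erase_of_mem ht, hX] at h4
        omega
    obtain hl | ⟨a, b, -, hXd, -, -, hXr⟩ :=
      exists_leaf_or_flat_corner (A := X) (Finset.card_pos.1 (by omega))
    · exact leaf hm hn (fun k hk _ _ h1 h2 h3 => ih k hk h1 h2 h3) X hX hXc hl
    obtain hl | ⟨a', b', -, hYd, -, -, hYr⟩ :=
      exists_leaf_or_flat_corner (A := Y) (Finset.card_pos.1 (by omega))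
    · rw [add_comm m n, add_comm (minCut m)]
      exact leaf hn hm (fun k hk _ _ h1 h2 h3 => ih k (by omega) h1 h2 h3) Y hY hYc hl
    set f := Tile.reflect (a + a') (b + b' + 1) with hf
    have hdis : Disjoint X (Y.map f.toEmbedding) := by
      rw [Finset.disjoint_left]
      intro s hs hs'
      obtain ⟨r, hr, rfl⟩ := Finset.mem_map.1 hs'
      have h1 := hXr _ hs
      have h2 := hYr _ hr
      simp only [Equiv.coe_toEmbedding, hf, Tile.row_reflect] at h1
      omega
    have hup : Tile.up a (b + 1) ∈ Y.map f.toEmbedding :=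
      Finset.mem_map.2 ⟨_, hYd, by simp [hf, Tile.reflect]; ring⟩
    have hlink : 1 ≤ ∑ t ∈ Y.map f.toEmbedding, #(t.nbrs ∩ X) :=
      (Finset.card_pos.2 ⟨Tile.down a b, by simp [Tile.nbrs, hXd]⟩).trans_le
        (Finset.single_le_sum (f := fun t : Tile => #(t.nbrs ∩ X)) (fun _ _ => Nat.zero_le _) hup)
    have h1 := cut_union hdis
    have h2 := minCut_le (X ∪ Y.map f.toEmbedding)
    rw [Finset.card_union_of_disjoint hdis, Finset.card_map, hX, hY] at h2
    rw [cut_map f (Tile.nbrs_reflect _ _)] at h1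
    omega

/-! ### Edges of tiles -/

theorem mem_powersetCard_two_triple {α : Type*} [DecidableEq α] {x y z : α} (hxy : x ≠ y)
    (hxz : x ≠ z) (hyz : y ≠ z) (e : Finset α) :
    e ∈ ({x, y, z} : Finset α).powersetCard 2 ↔ e = {x, y} ∨ e = {x, z} ∨ e = {y, z} := by
  rw [Finset.mem_powersetCard]
  constructor
  · rintro ⟨h, hc⟩
    obtain ⟨u, v, huv, rfl⟩ := Finset.card_eq_two.1 hc
    have hu := h (Finset.mem_insert_self u {v})
    have hv := h (Finset.mem_insert_of_mem (Finset.mem_singleton_self v))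
    simp only [Finset.mem_insert, Finset.mem_singleton] at hu hv
    rcases hu with rfl | rfl | rfl <;> rcases hv with rfl | rfl | rfl <;>
      simp_all [Finset.pair_comm]
  · rintro (rfl | rfl | rfl)
    · exact ⟨by simp, Finset.card_pair hxy⟩
    · exact ⟨by simp [Finset.insert_subset_iff], Finset.card_pair hxz⟩
    · exact ⟨by simp, Finset.card_pair hyz⟩

theorem mem_edges_up {a b : ℤ} {e : Finset LatticePoint} :
    e ∈ (Tile.up a b).edges ↔
      e = {(a, b), (a + 1, b)} ∨ e = {(a, b), (a, b + 1)} ∨ e = {(a + 1, b), (a, b + 1)} :=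
  mem_powersetCard_two_triple (by simp) (by simp) (by simp) e

theorem mem_edges_down {a b : ℤ} {e : Finset LatticePoint} :
    e ∈ (Tile.down a b).edges ↔
      e = {(a + 1, b), (a, b + 1)} ∨ e = {(a + 1, b), (a + 1, b + 1)} ∨
        e = {(a, b + 1), (a + 1, b + 1)} :=
  mem_powersetCard_two_triple (by simp) (by simp) (by simp) e

theorem Tile.card_vertices (t : Tile) : #t.vertices = 3 := by
  cases t <;> exact Finset.card_eq_three.2 ⟨_, _, _, by simp, by simp, by simp, rfl⟩

theorem Tile.card_edges (t : Tile) : #t.edges = 3 := by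
  rw [Tile.edges, Finset.card_powersetCard, t.card_vertices]; rfl

/-- Twice the midpoint of an edge of an upward tile. The parities of its coordinates tell the
direction of the edge, so that tiles with a common edge can be compared by arithmetic. -/
theorem sum_of_mem_edges_up {a b : ℤ} {e : Finset LatticePoint} (h : e ∈ (Tile.up a b).edges) :
    ∑ p ∈ e, p = (2 * a + 1, 2 * b) ∨ ∑ p ∈ e, p = (2 * a, 2 * b + 1) ∨
      ∑ p ∈ e, p = (2 * a + 1, 2 * b + 1) := by
  obtain rfl | rfl | rfl := mem_edges_up.1 h <;> rw [Finset.sum_pair (by simp)] <;>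
    simp only [Prod.mk_add_mk, Prod.mk.injEq] <;> omega

theorem sum_of_mem_edges_down {a b : ℤ} {e : Finset LatticePoint}
    (h : e ∈ (Tile.down a b).edges) :
    ∑ p ∈ e, p = (2 * a + 1, 2 * b + 1) ∨ ∑ p ∈ e, p = (2 * a + 2, 2 * b + 1) ∨
      ∑ p ∈ e, p = (2 * a + 1, 2 * b + 2) := by
  obtain rfl | rfl | rfl := mem_edges_down.1 h <;> rw [Finset.sum_pair (by simp)] <;>
    simp only [Prod.mk_add_mk, Prod.mk.injEq] <;> omega

theorem Tile.mem_nbrs_of_mem_edges {s t : Tile} {e : Finset LatticePoint} (hs : e ∈ s.edges)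
    (ht : e ∈ t.edges) (hst : s ≠ t) : s ∈ t.nbrs := by
  cases s <;> cases t <;> simp only [Tile.nbrs, Finset.mem_insert, Finset.mem_singleton,
    Tile.up.injEq, Tile.down.injEq, reduceCtorEq, or_false, ne_eq] at hst ⊢
  · have h1 := sum_of_mem_edges_up hs
    have h2 := sum_of_mem_edges_up ht
    simp only [Prod.ext_iff] at h1 h2
    omega
  · have h1 := sum_of_mem_edges_up hs
    have h2 := sum_of_mem_edges_down ht
    simp only [Prod.ext_iff] at h1 h2
    omega
  · have h1 := sum_of_mem_edges_down hs
    have h2 := sum_of_mem_edges_up ht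
    simp only [Prod.ext_iff] at h1 h2
    omega
  · have h1 := sum_of_mem_edges_down hs
    have h2 := sum_of_mem_edges_down ht
    simp only [Prod.ext_iff] at h1 h2
    omega

theorem Tile.exists_nbr_of_mem_edges {t : Tile} {e : Finset LatticePoint} (h : e ∈ t.edges) :
    ∃ s ∈ t.nbrs, e ∈ s.edges := by
  cases t with
  | up a b =>
    obtain rfl | rfl | rfl := mem_edges_up.1 h
    · exact ⟨.down a (b - 1), by simp [Tile.nbrs], by simp [mem_edges_down]⟩
    · exact ⟨.down (a - 1) b, by simp [Tile.nbrs], by simp [mem_edges_down]⟩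
    · exact ⟨.down a b, by simp [Tile.nbrs], by simp [mem_edges_down]⟩
  | down a b =>
    obtain rfl | rfl | rfl := mem_edges_down.1 h
    · exact ⟨.up a b, by simp [Tile.nbrs], by simp [mem_edges_up]⟩
    · exact ⟨.up (a + 1) b, by simp [Tile.nbrs], by simp [mem_edges_up]⟩
    · exact ⟨.up a (b + 1), by simp [Tile.nbrs], by simp [mem_edges_up]⟩

theorem Tile.exists_edge_of_mem_nbrs {s t : Tile} (h : s ∈ t.nbrs) :
    ∃ e, e ∈ s.edges ∧ e ∈ t.edges := by
  cases t <;> simp only [Tile.nbrs, Finset.mem_insert, Finset.mem_singleton] at h <;>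
    rcases h with rfl | rfl | rfl <;> simp only [mem_edges_up, mem_edges_down]
  · exact ⟨_, Or.inl rfl, by simp⟩
  · exact ⟨_, Or.inr (Or.inl rfl), by simp⟩
  · exact ⟨_, Or.inr (Or.inr rfl), by simp⟩
  · exact ⟨_, Or.inr (Or.inr rfl), by simp⟩
  · exact ⟨_, Or.inr (Or.inl rfl), by simp⟩
  · exact ⟨_, Or.inl rfl, by simp⟩

theorem tileGraph_adj {s t : Tile} : tileGraph.Adj s t ↔ s ∈ t.nbrs := by
  constructor
  · rintro ⟨h, e, hs, ht⟩
    exact Tile.mem_nbrs_of_mem_edges hs ht h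
  · exact fun h => ⟨fun hst => t.notMem_nbrs_self (hst ▸ h), Tile.exists_edge_of_mem_nbrs h⟩

/-- No edge belongs to three tiles. -/
theorem Tile.eq_of_mem_edges {r s t : Tile} {e : Finset LatticePoint} (hr : e ∈ r.edges)
    (hs : e ∈ s.edges) (ht : e ∈ t.edges) (hrt : r ≠ t) (hst : s ≠ t) : r = s := by
  by_contra h
  have h1 : r ∈ s.nbrs ∩ t.nbrs :=
    Finset.mem_inter.2 ⟨Tile.mem_nbrs_of_mem_edges hr hs h, Tile.mem_nbrs_of_mem_edges hr ht hrt⟩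
  rw [Tile.nbrs_inter_nbrs_eq_empty (Tile.mem_nbrs_of_mem_edges hs ht hst)] at h1
  simp at h1

theorem Tile.vertices_injective : Function.Injective Tile.vertices := by
  have hup : ∀ a b : ℤ, ∑ p ∈ (Tile.up a b).vertices, p = (3 * a + 1, 3 * b + 1) := fun a b => by
    rw [Tile.vertices, Finset.sum_insert (by simp), Finset.sum_pair (by simp)]
    simp only [Prod.mk_add_mk, Prod.mk.injEq]
    omega
  have hdown : ∀ a b : ℤ, ∑ p ∈ (Tile.down a b).vertices, p = (3 * a + 2, 3 * b + 2) :=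
    fun a b => by
      rw [Tile.vertices, Finset.sum_insert (by simp), Finset.sum_pair (by simp)]
      simp only [Prod.mk_add_mk, Prod.mk.injEq]
      omega
  intro s t h
  have h := congrArg (fun e : Finset LatticePoint => ∑ p ∈ e, p) h
  cases s <;> cases t <;> simp only [hup, hdown, Prod.mk.injEq] at h <;>
    simp only [Tile.up.injEq, Tile.down.injEq, reduceCtorEq] <;> omega

theorem Tile.eq_vertices_inter {s t : Tile} {e : Finset LatticePoint} (hs : e ∈ s.edges)
    (ht : e ∈ t.edges) (hst : s ≠ t) : e = s.vertices ∩ t.vertices := by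
  rw [Tile.edges, Finset.mem_powersetCard] at hs ht
  refine Finset.eq_of_subset_of_card_le (Finset.subset_inter hs.1 ht.1) ?_
  by_contra! h
  rw [hs.2] at h
  have h1 : s.vertices ∩ t.vertices = s.vertices :=
    Finset.eq_of_subset_of_card_le Finset.inter_subset_left (by rw [s.card_vertices]; exact h)
  have h2 : s.vertices ∩ t.vertices = t.vertices :=
    Finset.eq_of_subset_of_card_le Finset.inter_subset_right (by rw [t.card_vertices]; exact h)
  exact hst (Tile.vertices_injective (h1.symm.trans h2))

/-! ### Boundary edges and interior edges -/

/-- The edges between a tile of `A` and a tile outside `A`. -/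
def boundaryEdges (A : Finset Tile) : Set (Finset LatticePoint) :=
  {e | ∃ t ∈ A, ∃ s ∉ A, e ∈ t.edges ∧ e ∈ s.edges}

theorem ncard_boundaryEdges (A : Finset Tile) : (boundaryEdges A).ncard = cut A := by
  have h : boundaryEdges A =
      ((A.sigma fun t => t.nbrs \ A).image fun x => x.1.vertices ∩ x.2.vertices :
        Finset (Finset LatticePoint)) := by
    ext e
    simp only [boundaryEdges, Set.mem_ofPred_eq, Finset.coe_image, Set.mem_image, Finset.mem_coe,
      Finset.mem_sigma, Finset.mem_sdiff, Sigma.exists]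
    constructor
    · rintro ⟨t, ht, s, hs, het, hes⟩
      have hst : s ≠ t := fun h => hs (h ▸ ht)
      exact ⟨t, s, ⟨ht, Tile.mem_nbrs_of_mem_edges hes het hst, hs⟩,
        (Tile.eq_vertices_inter het hes hst.symm).symm⟩
    · rintro ⟨t, s, ⟨ht, hst, hs⟩, rfl⟩
      obtain ⟨e, hes, het⟩ := Tile.exists_edge_of_mem_nbrs hst
      rw [← Tile.eq_vertices_inter het hes fun h => hs (h ▸ ht)]
      exact ⟨t, ht, s, hs, het, hes⟩
  rw [h, Set.ncard_coe_finset, Finset.card_image_of_injOn, Finset.card_sigma, cut]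
  rintro ⟨t, s⟩ hx ⟨t', s'⟩ hx' hxx
  simp only [Finset.coe_sigma, Set.mem_sigma_iff, Finset.mem_coe, Finset.mem_sdiff] at hx hx' hxx
  obtain ⟨ht, hst, hs⟩ := hx
  obtain ⟨ht', hst', hs'⟩ := hx'
  obtain ⟨e, hes, het⟩ := Tile.exists_edge_of_mem_nbrs hst
  obtain ⟨e', hes', het'⟩ := Tile.exists_edge_of_mem_nbrs hst'
  rw [← Tile.eq_vertices_inter het hes fun h => hs (h ▸ ht),
    ← Tile.eq_vertices_inter het' hes' fun h => hs' (h ▸ ht')] at hxx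
  subst hxx
  obtain rfl := Tile.eq_of_mem_edges het het' hes (fun h => hs (h ▸ ht)) fun h => hs (h ▸ ht')
  obtain rfl := Tile.eq_of_mem_edges hes hes' het (fun h => hs (h ▸ ht)) fun h => hs' (h ▸ ht)
  rfl

/-- Each tile has three edges, and an edge of the shape belongs to two of its tiles if it is interior
and to one otherwise. -/
theorem cut_add_two_mul_interiorEdges (A : Finset Tile) : cut A + 2 * interiorEdges A = 3 * #A := by
  classical
  set E := A.biUnion Tile.edges with hE
  obtain ⟨I, hI⟩ : ∃ I : Finset LatticePoint → Prop,
      ∀ e, I e ↔ ∃ s ∈ A, ∃ t ∈ A, s ≠ t ∧ e ∈ s.edges ∧ e ∈ t.edges := ⟨_, fun _ => Iff.rfl⟩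
  have hint : interiorEdges A = #(E.filter fun e => I e) := by
    rw [interiorEdges, ← Set.ncard_coe_finset]
    congr 1
    ext e
    simp only [Set.mem_ofPred_eq, Finset.coe_filter, hE, Finset.mem_biUnion, hI]
    exact ⟨fun h => ⟨h.imp fun s hs => ⟨hs.1, hs.2.choose_spec.2.2.1⟩, h⟩, fun h => h.2⟩
  have hbd : cut A = #(E.filter fun e => ¬ I e) := by
    rw [← ncard_boundaryEdges, ← Set.ncard_coe_finset]
    congr 1
    ext e
    simp only [boundaryEdges, Set.mem_ofPred_eq, Finset.coe_filter, hE, Finset.mem_biUnion, hI]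
    constructor
    · rintro ⟨t, ht, s, hs, het, hes⟩
      refine ⟨⟨t, ht, het⟩, ?_⟩
      rintro ⟨r, hr, r', hr', hrr, her, her'⟩
      exact hrr (Tile.eq_of_mem_edges her her' hes (fun h => hs (h ▸ hr)) fun h => hs (h ▸ hr'))
    · rintro ⟨⟨t, ht, het⟩, h⟩
      obtain ⟨s, hst, hes⟩ := Tile.exists_nbr_of_mem_edges het
      refine ⟨t, ht, s, fun hs => h ⟨s, hs, t, ht, ?_, hes, het⟩, het, hes⟩
      rintro rfl
      exact s.notMem_nbrs_self hst
  -- Double counting of the incidences between tiles and edges.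
  have hdc : ∑ t ∈ A, #t.edges = ∑ e ∈ E, #(A.filter fun t => e ∈ t.edges) := by
    have h := Finset.sum_card_bipartiteAbove_eq_sum_card_bipartiteBelow
      (s := A) (t := E) (fun t e => e ∈ t.edges)
    rw [← show ∑ t ∈ A, #(E.bipartiteAbove (fun t e => e ∈ t.edges) t) = ∑ t ∈ A, #t.edges from
      Finset.sum_congr rfl fun t ht => ?_]
    · exact h
    · congr 1
      ext e
      simp only [Finset.bipartiteAbove, Finset.mem_filter, hE, Finset.mem_biUnion]
      exact ⟨fun h => h.2, fun h => ⟨⟨t, ht, h⟩, h⟩⟩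
  have hcount : ∀ e ∈ E, #(A.filter fun t => e ∈ t.edges) = 1 + if I e then 1 else 0 := by
    intro e he
    split_ifs with h
    · obtain ⟨s, hs, t, ht, hst, hes, het⟩ := (hI e).1 h
      rw [Finset.card_eq_two.2 ⟨s, t, hst, ?_⟩]
      ext r
      simp only [Finset.mem_filter, Finset.mem_insert, Finset.mem_singleton]
      constructor
      · rintro ⟨-, her⟩
        by_cases hrt : r = t
        · exact Or.inr hrt
        · exact Or.inl (Tile.eq_of_mem_edges her hes het hrt hst)
      · rintro (rfl | rfl)
        exacts [⟨hs, hes⟩, ⟨ht, het⟩]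
    · obtain ⟨t, ht, het⟩ := Finset.mem_biUnion.1 he
      rw [Finset.card_eq_one.2 ⟨t, ?_⟩]
      ext r
      simp only [Finset.mem_filter, Finset.mem_singleton]
      constructor
      · rintro ⟨hr, her⟩
        by_contra hrt
        exact h ((hI e).2 ⟨r, hr, t, ht, hrt, her, het⟩)
      · rintro rfl
        exact ⟨ht, het⟩
  rw [Finset.sum_congr rfl hcount, Finset.sum_add_distrib, ← Finset.card_eq_sum_ones,
    ← Finset.card_filter, Finset.sum_congr rfl fun t _ => t.card_edges, Finset.sum_const,
    smul_eq_mul] at hdc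
  have := Finset.card_filter_add_card_filter_not (s := E) fun e => I e
  omega

/-! ### Connected sets -/

theorem cut_add_sum_card_nbrs_inter (A : Finset Tile) :
    cut A + ∑ t ∈ A, #(t.nbrs ∩ A) = 3 * #A := by
  rw [cut, ← Finset.sum_add_distrib, mul_comm, ← smul_eq_mul, ← Finset.sum_const]
  refine Finset.sum_congr rfl fun t _ => ?_
  rw [Finset.card_sdiff_add_card_inter, t.card_nbrs]

theorem IsPolyiamond.nonempty {A : Finset Tile} (hA : IsPolyiamond A) : A.Nonempty := by
  obtain ⟨⟨t, ht⟩⟩ := SimpleGraph.Connected.nonempty hA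
  exact ⟨t, ht⟩

/-- A connected graph on `n` vertices has at least `n - 1` edges. -/
theorem IsPolyiamond.cut_le {A : Finset Tile} (hA : IsPolyiamond A) : cut A ≤ #A + 2 := by
  classical
  have h1 := SimpleGraph.Connected.card_vert_le_card_edgeSet_add_one hA
  have h2 := (tileGraph.induce (A : Set Tile)).sum_degrees_eq_twice_card_edges
  have h3 : ∑ t : (A : Set Tile), (tileGraph.induce (A : Set Tile)).degree t =
      ∑ t ∈ A, #(t.nbrs ∩ A) := by
    rw [← Finset.sum_coe_sort A fun t => #(t.nbrs ∩ A)]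
    refine Finset.sum_congr rfl fun t _ => ?_
    rw [← SimpleGraph.card_neighborFinset_eq_degree, ← Finset.card_map (Function.Embedding.subtype _)]
    congr 1
    ext r
    simp only [Finset.mem_map, SimpleGraph.mem_neighborFinset, SimpleGraph.comap_adj,
      Function.Embedding.subtype_apply, tileGraph_adj, Finset.mem_inter]
    constructor
    · rintro ⟨⟨s, hs⟩, h, rfl⟩
      exact ⟨Tile.mem_nbrs_comm.1 h, hs⟩
    · rintro ⟨h, hs⟩
      exact ⟨⟨r, hs⟩, Tile.mem_nbrs_comm.1 h, rfl⟩
  have h4 := cut_add_sum_card_nbrs_inter A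
  rw [Nat.card_eq_fintype_card, Nat.card_eq_fintype_card, ← SimpleGraph.edgeFinset_card] at h1
  have h5 : Fintype.card (A : Set Tile) = #A := by simp
  omega

theorem IsPolyiamond.insert {A : Finset Tile} (hA : IsPolyiamond A) {s t : Tile} (hs : s ∈ A)
    (hst : s ∈ t.nbrs) : IsPolyiamond (insert t A) := by
  have h := SimpleGraph.induce_union_connected (SimpleGraph.Connected.preconnected hA)
    (SimpleGraph.induce_pair_connected_of_adj (tileGraph_adj.2 hst)).preconnected ⟨s, hs, by simp⟩
  have hset : (A : Set Tile) ∪ {s, t} = (Insert.insert t A : Finset Tile) := by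
    ext r
    simp only [Finset.coe_insert, Set.mem_insert_iff, Set.mem_union, Finset.mem_coe,
      Set.mem_singleton_iff]
    constructor
    · rintro (h | rfl | h) <;> tauto
    · tauto
  rwa [hset] at h

/-- A set of tiles with the least boundary among the sets of its size is connected: otherwise its
parts could be glued along an edge. -/
theorem isPolyiamond_of_cut_eq_minCut {A : Finset Tile} (hA : A.Nonempty)
    (h : cut A = minCut #A) : IsPolyiamond A := by
  classical
  obtain ⟨t₀, ht₀⟩ := hA
  set G := tileGraph.induce (A : Set Tile)
  by_contra hcon
  set X := A.filter fun t => ∃ ht : t ∈ A, G.Reachable ⟨t₀, ht₀⟩ ⟨t, ht⟩ with hX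
  have ht₀X : t₀ ∈ X := by simp [hX, ht₀]
  have hXA : X ⊆ A := Finset.filter_subset _ _
  have hY : (A \ X).Nonempty := by
    by_contra hY
    rw [Finset.not_nonempty_iff_eq_empty, Finset.sdiff_eq_empty_iff_subset] at hY
    refine hcon ((SimpleGraph.connected_iff_exists_forall_reachable _).2 ⟨⟨t₀, ht₀⟩, fun t => ?_⟩)
    exact (Finset.mem_filter.1 (hY t.2)).2.2
  have h1 := cut_union (Finset.disjoint_sdiff (s := X) (t := A))
  rw [Finset.union_sdiff_of_subset hXA, Finset.sum_eq_zero, h] at h1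
  · have h2 := minCut_le X
    have h3 := minCut_le (A \ X)
    have h4 := minCut_add_add_two_le (Finset.card_pos.2 ⟨t₀, ht₀X⟩) hY.card_pos
    rw [add_comm #X, Finset.card_sdiff_add_card_eq_card hXA] at h4
    omega
  · intro t ht
    rw [Finset.card_eq_zero, Finset.eq_empty_iff_forall_notMem]
    intro s hs
    obtain ⟨htA, htX⟩ := Finset.mem_sdiff.1 ht
    obtain ⟨hst, hs⟩ := Finset.mem_inter.1 hs
    obtain ⟨-, hsA, hr⟩ := Finset.mem_filter.1 hs
    refine htX (Finset.mem_filter.2 ⟨htA, htA, hr.trans (SimpleGraph.Adj.reachable ?_)⟩)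
    exact tileGraph_adj.2 hst

/-- The tiles of a horizontal strip, from left to right. -/
def stripTile (i : ℕ) : Tile := if i % 2 = 0 then .up (i / 2 : ℕ) 0 else .down (i / 2 : ℕ) 0

/-- The first `n + 1` tiles of a horizontal strip form a path in the adjacency graph. -/
theorem exists_isPolyiamond_cut_eq (n : ℕ) :
    ∃ A : Finset Tile, IsPolyiamond A ∧ #A = n + 1 ∧ cut A = n + 3 := by
  have hinj : ∀ i j, stripTile i = stripTile j → i = j := by
    intro i j h
    unfold stripTile at h
    split_ifs at h <;> simp at h <;> omega
  have hnbr : ∀ i j, stripTile j ∈ (stripTile i).nbrs ↔ j = i + 1 ∨ i = j + 1 := by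
    intro i j
    unfold stripTile
    split_ifs <;> simp [Tile.nbrs] <;> omega
  suffices h : ∃ A : Finset Tile, (IsPolyiamond A ∧ #A = n + 1 ∧ cut A = n + 3) ∧
      A = (Finset.range (n + 1)).image stripTile from h.imp fun _ h => h.1
  refine ⟨_, ?_, rfl⟩
  induction n with
  | zero =>
    refine ⟨isPolyiamond_of_cut_eq_minCut (by simp) ?_, by simp, by simp [cut_singleton]⟩
    simp [cut_singleton, minCut_one]
  | succ n ih =>
    obtain ⟨h1, h2, h3⟩ := ih
    have hn : stripTile (n + 1) ∉ (Finset.range (n + 1)).image stripTile := by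
      simp only [Finset.mem_image, Finset.mem_range, not_exists, not_and]
      intro i hi h
      have := hinj _ _ h
      omega
    rw [Finset.range_add_one (n := n + 1), Finset.image_insert]
    have h4 := cut_insert hn
    have h5 : (stripTile (n + 1)).nbrs ∩ (Finset.range (n + 1)).image stripTile =
        {stripTile n} := by
      ext t
      simp only [Finset.mem_inter, Finset.mem_image, Finset.mem_range, Finset.mem_singleton]
      constructor
      · rintro ⟨ht, i, hi, rfl⟩
        rw [hnbr] at ht
        rw [show i = n by omega]
      · rintro rfl
        exact ⟨by simp [hnbr], n, by omega, rfl⟩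
    rw [h5, Finset.card_singleton] at h4
    refine ⟨h1.insert (s := stripTile n) ?_ (by simp [hnbr]), ?_, by omega⟩
    · exact Finset.mem_image_of_mem _ (by simp)
    · rw [Finset.card_insert_of_notMem hn, h2]

theorem bMin_eq {n : ℕ} (hn : 1 ≤ n) : bMin n + 1 = n := by
  obtain ⟨n, rfl⟩ := Nat.exists_eq_add_of_le' hn
  refine congrArg (· + 1) (IsLeast.csInf_eq ⟨?_, ?_⟩)
  · obtain ⟨A, hA, hc, h⟩ := exists_isPolyiamond_cut_eq n
    have := cut_add_two_mul_interiorEdges A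
    exact ⟨A, hA, hc, by omega⟩
  · rintro _ ⟨A, hA, hc, rfl⟩
    have := cut_add_two_mul_interiorEdges A
    have := hA.cut_le
    omega

/-! ### Tiles in the plane -/

/-- The first affine coordinate of a point of the plane with respect to the lattice basis. -/
noncomputable def coordX : ℂ →L[ℝ] ℝ := Complex.reCLM - (√3)⁻¹ • Complex.imCLM

/-- The second affine coordinate of a point of the plane with respect to the lattice basis. -/
noncomputable def coordY : ℂ →L[ℝ] ℝ := (2 * (√3)⁻¹) • Complex.imCLM

/-- The point of the plane with given coordinates with respect to the lattice basis. -/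
noncomputable def ofCoord (x y : ℝ) : ℂ := ⟨x + y / 2, √3 / 2 * y⟩

theorem coordX_apply (z : ℂ) : coordX z = z.re - (√3)⁻¹ * z.im := by simp [coordX]

theorem coordY_apply (z : ℂ) : coordY z = 2 * (√3)⁻¹ * z.im := by simp [coordY]

@[simp]
theorem coordX_ofCoord (x y : ℝ) : coordX (ofCoord x y) = x := by
  have : √3 ≠ 0 := by positivity
  rw [coordX_apply, ofCoord]
  field_simp
  ring

@[simp]
theorem coordY_ofCoord (x y : ℝ) : coordY (ofCoord x y) = y := by
  have : √3 ≠ 0 := by positivity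
  rw [coordY_apply, ofCoord]
  field_simp

theorem ext_coord {z w : ℂ} (hx : coordX z = coordX w) (hy : coordY z = coordY w) : z = w := by
  have h3 : (√3)⁻¹ ≠ 0 := by positivity
  rw [coordY_apply, coordY_apply] at hy
  have him : z.im = w.im := mul_left_cancel₀ (mul_ne_zero two_ne_zero h3) hy
  rw [coordX_apply, coordX_apply, him] at hx
  exact Complex.ext (sub_left_injective hx) him

theorem pos_eq_ofCoord (v : LatticePoint) : pos v = ofCoord v.1 v.2 := rfl

theorem smul_add_smul_add_smul_mem_hull {p q r : LatticePoint} {u v w : ℝ} (hu : 0 ≤ u)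
    (hv : 0 ≤ v) (hw : 0 ≤ w) (h : u + v + w = 1) :
    u • pos p + v • pos q + w • pos r ∈ hull {p, q, r} := by
  have hmem : ∀ x ∈ ({p, q, r} : Finset LatticePoint), pos x ∈ hull {p, q, r} := fun x hx =>
    subset_convexHull ℝ _ (Set.mem_image_of_mem pos hx)
  have := (convex_convexHull ℝ (pos '' (({p, q, r} : Finset LatticePoint) : Set LatticePoint))).sum_mem
    (t := Finset.univ) (w := ![u, v, w]) (z := ![pos p, pos q, pos r])
    (by intro i _; fin_cases i <;> simpa) (by simpa [Fin.sum_univ_three] using h)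
    (by intro i _; fin_cases i <;> exact hmem _ (by simp))
  simpa [hull, Fin.sum_univ_three] using this

theorem mem_hull_up {a b : ℤ} {z : ℂ} : z ∈ hull (Tile.up a b).vertices ↔
    a ≤ coordX z ∧ b ≤ coordY z ∧ coordX z + coordY z ≤ a + b + 1 := by
  constructor
  · have hconv : Convex ℝ (coordX ⁻¹' Set.Ici (a : ℝ) ∩ (coordY ⁻¹' Set.Ici (b : ℝ) ∩
        (coordX + coordY) ⁻¹' Set.Iic (a + b + 1 : ℝ))) :=
      ((convex_Ici _).linear_preimage coordX.toLinearMap).inter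
        (((convex_Ici _).linear_preimage coordY.toLinearMap).inter
          ((convex_Iic _).linear_preimage (coordX + coordY).toLinearMap))
    intro hz
    refine convexHull_min ?_ hconv hz
    rintro _ ⟨v, hv, rfl⟩
    simp only [Tile.vertices, Finset.coe_insert, Finset.coe_singleton, Set.mem_insert_iff,
      Set.mem_singleton_iff] at hv
    rcases hv with rfl | rfl | rfl <;>
      simp only [pos_eq_ofCoord, Set.mem_inter_iff, Set.mem_preimage, Set.mem_Ici, Set.mem_Iic,
        _root_.add_apply, coordX_ofCoord, coordY_ofCoord] <;> push_cast <;>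
      refine ⟨?_, ?_, ?_⟩ <;> linarith
  · rintro ⟨h1, h2, h3⟩
    have h := smul_add_smul_add_smul_mem_hull (p := (a, b)) (q := (a + 1, b)) (r := (a, b + 1))
      (u := a + b + 1 - coordX z - coordY z) (v := coordX z - a) (w := coordY z - b)
      (by linarith) (by linarith) (by linarith) (by ring)
    change z ∈ hull {(a, b), (a + 1, b), (a, b + 1)}
    convert h using 1
    apply ext_coord <;> simp only [map_add, map_smul, pos_eq_ofCoord, coordX_ofCoord,
      coordY_ofCoord, smul_eq_mul] <;> push_cast <;> ring

theorem mem_hull_down {a b : ℤ} {z : ℂ} : z ∈ hull (Tile.down a b).vertices ↔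
    coordX z ≤ a + 1 ∧ coordY z ≤ b + 1 ∧ a + b + 1 ≤ coordX z + coordY z := by
  constructor
  · have hconv : Convex ℝ (coordX ⁻¹' Set.Iic (a + 1 : ℝ) ∩ (coordY ⁻¹' Set.Iic (b + 1 : ℝ) ∩
        (coordX + coordY) ⁻¹' Set.Ici (a + b + 1 : ℝ))) :=
      ((convex_Iic _).linear_preimage coordX.toLinearMap).inter
        (((convex_Iic _).linear_preimage coordY.toLinearMap).inter
          ((convex_Ici _).linear_preimage (coordX + coordY).toLinearMap))
    intro hz
    refine convexHull_min ?_ hconv hz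
    rintro _ ⟨v, hv, rfl⟩
    simp only [Tile.vertices, Finset.coe_insert, Finset.coe_singleton, Set.mem_insert_iff,
      Set.mem_singleton_iff] at hv
    rcases hv with rfl | rfl | rfl <;>
      simp only [pos_eq_ofCoord, Set.mem_inter_iff, Set.mem_preimage, Set.mem_Ici, Set.mem_Iic,
        _root_.add_apply, coordX_ofCoord, coordY_ofCoord] <;> push_cast <;>
      refine ⟨?_, ?_, ?_⟩ <;> linarith
  · rintro ⟨h1, h2, h3⟩
    have h := smul_add_smul_add_smul_mem_hull (p := (a + 1, b)) (q := (a, b + 1))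
      (r := (a + 1, b + 1)) (u := b + 1 - coordY z) (v := a + 1 - coordX z)
      (w := coordX z + coordY z - a - b - 1)
      (by linarith) (by linarith) (by linarith) (by ring)
    change z ∈ hull {(a + 1, b), (a, b + 1), (a + 1, b + 1)}
    convert h using 1
    apply ext_coord <;> simp only [map_add, map_smul, pos_eq_ofCoord, coordX_ofCoord,
      coordY_ofCoord, smul_eq_mul] <;> push_cast <;> ring

/-- The open triangle of a tile, given by strict inequalities between coordinates. -/
noncomputable def Tile.openTile : Tile → Set ℂ
  | .up a b => {z | a < coordX z ∧ b < coordY z ∧ coordX z + coordY z < a + b + 1}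
  | .down a b => {z | coordX z < a + 1 ∧ coordY z < b + 1 ∧ a + b + 1 < coordX z + coordY z}

theorem Tile.convex_openTile (t : Tile) : Convex ℝ t.openTile := by
  cases t with
  | up a b =>
    exact ((convex_Ioi (a : ℝ)).linear_preimage coordX.toLinearMap).inter
      (((convex_Ioi (b : ℝ)).linear_preimage coordY.toLinearMap).inter
        ((convex_Iio (a + b + 1 : ℝ)).linear_preimage (coordX + coordY).toLinearMap))
  | down a b =>
    exact ((convex_Iio (a + 1 : ℝ)).linear_preimage coordX.toLinearMap).inter
      (((convex_Iio (b + 1 : ℝ)).linear_preimage coordY.toLinearMap).inter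
        ((convex_Ioi (a + b + 1 : ℝ)).linear_preimage (coordX + coordY).toLinearMap))

theorem Tile.openTile_subset_hull (t : Tile) : t.openTile ⊆ hull t.vertices := by
  cases t with
  | up a b => exact fun z hz => mem_hull_up.2 ⟨hz.1.le, hz.2.1.le, hz.2.2.le⟩
  | down a b => exact fun z hz => mem_hull_down.2 ⟨hz.1.le, hz.2.1.le, hz.2.2.le⟩

/-- The centre of a tile. -/
noncomputable def Tile.center : Tile → ℂ
  | .up a b => ofCoord (a + 1 / 3) (b + 1 / 3)
  | .down a b => ofCoord (a + 2 / 3) (b + 2 / 3)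

theorem Tile.center_mem_openTile (t : Tile) : t.center ∈ t.openTile := by
  cases t <;> simp only [Tile.center, Tile.openTile, Set.mem_ofPred_eq, coordX_ofCoord,
    coordY_ofCoord] <;> refine ⟨?_, ?_, ?_⟩ <;> linarith

theorem Tile.hull_subset_closure_openTile (t : Tile) :
    hull t.vertices ⊆ closure t.openTile := by
  intro z hz
  have hsub : openSegment ℝ t.center z ⊆ t.openTile := by
    rintro _ ⟨u, v, hu, hv, huv, rfl⟩
    obtain rfl : u = 1 - v := by linarith
    cases t with
    | up a b =>
      obtain ⟨h1, h2, h3⟩ := mem_hull_up.1 hz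
      simp only [Tile.center, Tile.openTile, Set.mem_ofPred_eq, map_add, map_smul, coordX_ofCoord,
        coordY_ofCoord, smul_eq_mul]
      refine ⟨?_, ?_, ?_⟩ <;> nlinarith
    | down a b =>
      obtain ⟨h1, h2, h3⟩ := mem_hull_down.1 hz
      simp only [Tile.center, Tile.openTile, Set.mem_ofPred_eq, map_add, map_smul, coordX_ofCoord,
        coordY_ofCoord, smul_eq_mul]
      refine ⟨?_, ?_, ?_⟩ <;> nlinarith
  have h := closure_mono hsub
  rw [closure_openSegment] at h
  exact h (right_mem_segment ℝ _ _)

/-- Both coordinates and their sum have known integer parts on an open tile, which leaves no room for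
another closed tile. -/
theorem Tile.disjoint_openTile_hull {s t : Tile} (h : s ≠ t) :
    Disjoint s.openTile (hull t.vertices) := by
  rw [Set.disjoint_left]
  intro z hs ht
  apply h
  have key : ∀ m n : ℤ, (m : ℝ) < n + 1 → m ≤ n := fun m n hmn => by
    rw [← Int.lt_add_one_iff]; exact_mod_cast hmn
  cases s with
  | up a b =>
    obtain ⟨h1, h2, h3⟩ := hs
    cases t with
    | up a' b' =>
      rw [mem_hull_up] at ht
      have e1 := key a' a (by linarith)
      have e2 := key b' b (by linarith)
      have e3 := key (a + b) (a' + b') (by push_cast; linarith)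
      rw [Tile.up.injEq]; omega
    | down a' b' =>
      rw [mem_hull_down] at ht
      have e1 := key a a' (by linarith)
      have e2 := key b b' (by linarith)
      have e3 := key (a' + b' + 1) (a + b) (by push_cast; linarith)
      omega
  | down a b =>
    obtain ⟨h1, h2, h3⟩ := hs
    cases t with
    | up a' b' =>
      rw [mem_hull_up] at ht
      have e1 := key a' a (by linarith)
      have e2 := key b' b (by linarith)
      have e3 := key (a + b + 1) (a' + b') (by push_cast; linarith)
      omega
    | down a' b' =>
      rw [mem_hull_down] at ht
      have e1 := key a a' (by linarith)
      have e2 := key b b' (by linarith)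
      have e3 := key (a' + b') (a + b) (by push_cast; linarith)
      rw [Tile.down.injEq]; omega

theorem exists_mem_hull (z : ℂ) : ∃ t : Tile, z ∈ hull t.vertices := by
  have hx := Int.floor_le (coordX z)
  have hx' := (Int.lt_floor_add_one (coordX z)).le
  have hy := Int.floor_le (coordY z)
  have hy' := (Int.lt_floor_add_one (coordY z)).le
  obtain h | h := le_total (coordX z + coordY z) (⌊coordX z⌋ + ⌊coordY z⌋ + 1)
  · exact ⟨.up ⌊coordX z⌋ ⌊coordY z⌋, mem_hull_up.2 ⟨hx, hy, h⟩⟩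
  · exact ⟨.down ⌊coordX z⌋ ⌊coordY z⌋, mem_hull_down.2 ⟨hx', hy', h⟩⟩

theorem hull_subset_of_mem_edges {t : Tile} {e : Finset LatticePoint} (h : e ∈ t.edges) :
    hull e ⊆ hull t.vertices :=
  convexHull_mono (Set.image_mono (Finset.coe_subset.2 (Finset.mem_powersetCard.1 h).1))

theorem midpoint_mem_hull (p q : LatticePoint) :
    ofCoord ((p.1 + q.1) / 2) ((p.2 + q.2) / 2) ∈ hull {p, q} := by
  have h := smul_add_smul_add_smul_mem_hull (p := p) (q := q) (r := q) (u := 1 / 2) (v := 1 / 2)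
    (w := 0) (by norm_num) (by norm_num) le_rfl (by norm_num)
  rw [Finset.pair_eq_singleton] at h
  convert h using 1
  apply ext_coord <;> simp only [map_add, map_smul, pos_eq_ofCoord, coordX_ofCoord,
    coordY_ofCoord, smul_eq_mul] <;> ring

/-- The midpoint of the common edge of two tiles is an interior point of their union. -/
theorem exists_mem_hull_edge_mem_interior {s t : Tile} {e : Finset LatticePoint}
    (hs : e ∈ s.edges) (ht : e ∈ t.edges) (hst : s ≠ t) :
    ∃ m ∈ hull e, m ∈ interior (hull s.vertices ∪ hull t.vertices) := by
  wlog hup : ∃ a b, t = .up a b generalizing s t with H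
  · have hn := Tile.mem_nbrs_of_mem_edges hs ht hst
    rw [Set.union_comm]
    refine H ht hs hst.symm ?_
    cases t with
    | up a b => exact absurd ⟨a, b, rfl⟩ hup
    | down a b =>
      simp only [Tile.nbrs, Finset.mem_insert, Finset.mem_singleton] at hn
      rcases hn with rfl | rfl | rfl <;> exact ⟨_, _, rfl⟩
  obtain ⟨a, b, rfl⟩ := hup
  have hX := coordX.continuous
  have hY := coordY.continuous
  have hopen : ∀ (f g : ℂ → ℝ) (u v : ℝ), Continuous f → Continuous g →
      IsOpen {z | u < f z ∧ f z < u + 1 ∧ v < g z ∧ g z < v + 1} := fun f g u v hf hg =>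
    (isOpen_lt continuous_const hf).inter ((isOpen_lt hf continuous_const).inter
      ((isOpen_lt continuous_const hg).inter (isOpen_lt hg continuous_const)))
  obtain rfl | rfl | rfl := mem_edges_up.1 ht
  · obtain rfl : s = .down a (b - 1) :=
      Tile.eq_of_mem_edges hs (by simp [mem_edges_down]) ht hst (by simp)
    refine ⟨_, midpoint_mem_hull _ _, mem_interior.2 ⟨_, ?_,
      hopen coordX (fun z => coordX z + coordY z) a (a + b) hX (hX.add hY), ?_⟩⟩
    · rintro z ⟨h1, h2, h3, h4⟩
      rw [Set.mem_union, mem_hull_up, mem_hull_down]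
      push_cast
      obtain h | h := le_total (coordY z) b
      · left; refine ⟨?_, ?_, ?_⟩ <;> linarith
      · right; refine ⟨?_, ?_, ?_⟩ <;> linarith
    · simp only [Set.mem_ofPred_eq, coordX_ofCoord, coordY_ofCoord]
      push_cast
      refine ⟨?_, ?_, ?_, ?_⟩ <;> linarith
  · obtain rfl : s = .down (a - 1) b :=
      Tile.eq_of_mem_edges hs (by simp [mem_edges_down]) ht hst (by simp)
    refine ⟨_, midpoint_mem_hull _ _, mem_interior.2 ⟨_, ?_,
      hopen coordY (fun z => coordX z + coordY z) b (a + b) hY (hX.add hY), ?_⟩⟩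
    · rintro z ⟨h1, h2, h3, h4⟩
      rw [Set.mem_union, mem_hull_up, mem_hull_down]
      push_cast
      obtain h | h := le_total (coordX z) a
      · left; refine ⟨?_, ?_, ?_⟩ <;> linarith
      · right; refine ⟨?_, ?_, ?_⟩ <;> linarith
    · simp only [Set.mem_ofPred_eq, coordX_ofCoord, coordY_ofCoord]
      push_cast
      refine ⟨?_, ?_, ?_, ?_⟩ <;> linarith
  · obtain rfl : s = .down a b :=
      Tile.eq_of_mem_edges hs (by simp [mem_edges_down]) ht hst (by simp)
    refine ⟨_, midpoint_mem_hull _ _, mem_interior.2 ⟨_, ?_, hopen coordX coordY a b hX hY, ?_⟩⟩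
    · rintro z ⟨h1, h2, h3, h4⟩
      rw [Set.mem_union, mem_hull_up, mem_hull_down]
      obtain h | h := le_total (a + b + 1 : ℝ) (coordX z + coordY z)
      · left; refine ⟨?_, ?_, ?_⟩ <;> linarith
      · right; refine ⟨?_, ?_, ?_⟩ <;> linarith
    · simp only [Set.mem_ofPred_eq, coordX_ofCoord, coordY_ofCoord]
      push_cast
      refine ⟨?_, ?_, ?_, ?_⟩ <;> linarith

/-! ### The topological boundary of a shape -/

theorem hull_subset_region {A : Finset Tile} {t : Tile} (h : t ∈ A) :
    hull t.vertices ⊆ region A := Set.subset_biUnion_of_mem (u := fun t : Tile => hull t.vertices) h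

theorem isClosed_region (A : Finset Tile) : IsClosed (region A) :=
  A.finite_toSet.isClosed_biUnion fun _ _ =>
    (((Finset.finite_toSet _).image pos).isCompact_convexHull (𝕜 := ℝ)).isClosed

theorem disjoint_openTile_region {A : Finset Tile} {t : Tile} (h : t ∉ A) :
    Disjoint t.openTile (region A) :=
  Set.disjoint_iUnion₂_right.2 fun _ hs => Tile.disjoint_openTile_hull fun hts => h (hts ▸ hs)

/-- An edge of a shape is on its topological boundary exactly if the tile on the other side is
missing. -/
theorem hull_subset_frontier_region_iff {A : Finset Tile} {t : Tile} {e : Finset LatticePoint}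
    (ht : t ∈ A) (he : e ∈ t.edges) :
    hull e ⊆ frontier (region A) ↔ ∃ s ∉ A, e ∈ s.edges := by
  constructor
  · intro h
    by_contra! hA
    obtain ⟨s, hst, hs⟩ := Tile.exists_nbr_of_mem_edges he
    have hsA : s ∈ A := by_contra fun hsA => hA s hsA hs
    obtain ⟨m, hm, hmi⟩ := exists_mem_hull_edge_mem_interior hs he
      fun h => t.notMem_nbrs_self (h ▸ hst)
    exact (h hm).2 (interior_mono
      (Set.union_subset (hull_subset_region hsA) (hull_subset_region ht)) hmi)
  · rintro ⟨s, hsA, hs⟩ z hz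
    refine ⟨subset_closure (hull_subset_region ht (hull_subset_of_mem_edges he hz)), fun hzi => ?_⟩
    obtain ⟨w, hwi, hws⟩ := mem_closure_iff.1
      (s.hull_subset_closure_openTile (hull_subset_of_mem_edges hs hz)) _ isOpen_interior hzi
    exact Set.disjoint_left.1 (disjoint_openTile_region hsA) hws (interior_subset hwi)

theorem perimeter_eq_cut (A : Finset Tile) : perimeter A = cut A := by
  rw [perimeter, ← ncard_boundaryEdges]
  congr 1
  ext e
  simp only [boundaryEdges, Set.mem_ofPred_eq]
  constructor
  · rintro ⟨⟨t, ht, he⟩, h⟩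
    obtain ⟨s, hs, hes⟩ := (hull_subset_frontier_region_iff ht he).1 h
    exact ⟨t, ht, s, hs, he, hes⟩
  · rintro ⟨t, ht, s, hs, he, hes⟩
    exact ⟨⟨t, ht, he⟩, (hull_subset_frontier_region_iff ht he).2 ⟨s, hs, hes⟩⟩

/-! ### Components of the complement -/

/-- The open triangles of two adjacent tiles lie in a connected set that avoids all other tiles. -/
theorem exists_isPreconnected_of_mem_nbrs {s t : Tile} (h : s ∈ t.nbrs) :
    ∃ W : Set ℂ, IsPreconnected W ∧ s.openTile ⊆ W ∧ t.openTile ⊆ W ∧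
      ∀ r, r ≠ s → r ≠ t → Disjoint W (hull r.vertices) := by
  obtain ⟨e, hs, ht⟩ := Tile.exists_edge_of_mem_nbrs h
  obtain ⟨m, hm, hmi⟩ := exists_mem_hull_edge_mem_interior hs ht
    fun hst => t.notMem_nbrs_self (hst ▸ h)
  have hcon : ∀ r : Tile, e ∈ r.edges → IsPreconnected (insert m r.openTile) := fun r hr =>
    r.convex_openTile.isPreconnected.subset_closure (Set.subset_insert _ _)
      (Set.insert_subset (r.hull_subset_closure_openTile (hull_subset_of_mem_edges hr hm))
        subset_closure)
  refine ⟨insert m s.openTile ∪ insert m t.openTile,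
    (hcon s hs).union m (Set.mem_insert _ _) (Set.mem_insert _ _) (hcon t ht),
    (Set.subset_insert _ _).trans Set.subset_union_left,
    (Set.subset_insert _ _).trans Set.subset_union_right, fun r hrs hrt => ?_⟩
  have hmr : m ∉ hull r.vertices := fun hmr => by
    obtain ⟨w, hwi, hwr⟩ := mem_closure_iff.1 (r.hull_subset_closure_openTile hmr) _
      isOpen_interior hmi
    obtain hw | hw := interior_subset hwi
    · exact Set.disjoint_left.1 (Tile.disjoint_openTile_hull hrs) hwr hw
    · exact Set.disjoint_left.1 (Tile.disjoint_openTile_hull hrt) hwr hw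
  rw [Set.disjoint_union_left, Set.disjoint_insert_left, Set.disjoint_insert_left]
  exact ⟨⟨hmr, Tile.disjoint_openTile_hull hrs.symm⟩, hmr, Tile.disjoint_openTile_hull hrt.symm⟩

theorem finite_setOf_openTile_subset {C : Set ℂ} (hC : Bornology.IsBounded C) :
    {t : Tile | t.openTile ⊆ C}.Finite := by
  obtain ⟨R, hR⟩ : ∃ R : ℕ, ∀ z ∈ C, |coordX z| < R ∧ |coordY z| < R := by
    obtain ⟨R, hR⟩ := isBounded_iff_forall_norm_le.1 (hC.image coordX)
    obtain ⟨S, hS⟩ := isBounded_iff_forall_norm_le.1 (hC.image coordY)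
    obtain ⟨N, hN⟩ := exists_nat_gt (max R S)
    exact ⟨N, fun z hz => ⟨(hR _ ⟨z, hz, rfl⟩).trans_lt ((le_max_left _ _).trans_lt hN),
      (hS _ ⟨z, hz, rfl⟩).trans_lt ((le_max_right _ _).trans_lt hN)⟩⟩
  have hcast : ∀ a : ℤ, ∀ δ : ℝ, 0 < δ → δ < 1 → |(a : ℝ) + δ| < R →
      a ∈ Set.Icc (-(R : ℤ) - 1) R := by
    intro a δ h0 h1 h
    rw [abs_lt] at h
    have e1 : (-(R : ℤ) - 1 : ℤ) ≤ (a : ℝ) := by push_cast; linarith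
    have e2 : (a : ℝ) ≤ (R : ℤ) := by push_cast; linarith
    exact ⟨by exact_mod_cast e1, by exact_mod_cast e2⟩
  have hI : (Set.Icc (-(R : ℤ) - 1) R ×ˢ Set.Icc (-(R : ℤ) - 1) R).Finite :=
    (Set.finite_Icc _ _).prod (Set.finite_Icc _ _)
  refine ((hI.image fun p => Tile.up p.1 p.2).union
    (hI.image fun p => Tile.down p.1 p.2)).subset fun t ht => ?_
  have h := hR _ (ht t.center_mem_openTile)
  cases t with
  | up a b =>
    simp only [Tile.center, coordX_ofCoord, coordY_ofCoord] at h
    exact Or.inl ⟨(a, b), ⟨hcast a _ (by norm_num) (by norm_num) h.1,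
      hcast b _ (by norm_num) (by norm_num) h.2⟩, rfl⟩
  | down a b =>
    simp only [Tile.center, coordX_ofCoord, coordY_ofCoord] at h
    exact Or.inr ⟨(a, b), ⟨hcast a _ (by norm_num) (by norm_num) h.1,
      hcast b _ (by norm_num) (by norm_num) h.2⟩, rfl⟩

/-- The tiles of a component of the complement of a shape: there is one, none of them belongs to the
shape, and all their neighbours outside the shape are among them. -/
theorem openTile_subset_component {A : Finset Tile} {C : Set ℂ}
    (hC : ∃ x ∈ (region A)ᶜ, C = connectedComponentIn (region A)ᶜ x) :
    (∃ t : Tile, t.openTile ⊆ C) ∧ (∀ t : Tile, t.openTile ⊆ C → t ∉ A) ∧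
      ∀ t : Tile, t.openTile ⊆ C → ∀ s ∈ t.nbrs, s ∉ A → s.openTile ⊆ C := by
  obtain ⟨x, hx, rfl⟩ := hC
  -- A connected subset of the complement that meets the component is contained in it.
  have key : ∀ W : Set ℂ, IsPreconnected W → W ⊆ (region A)ᶜ →
      (W ∩ connectedComponentIn (region A)ᶜ x).Nonempty → W ⊆ connectedComponentIn (region A)ᶜ x := by
    rintro W hW hWA ⟨y, hyW, hy⟩
    rw [connectedComponentIn_eq hy]
    exact hW.subset_connectedComponentIn hyW hWA
  have hnot : ∀ t : Tile, t.openTile ⊆ connectedComponentIn (region A)ᶜ x → t ∉ A :=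
    fun t ht htA => connectedComponentIn_subset _ _ (ht t.center_mem_openTile)
      (hull_subset_region htA (t.openTile_subset_hull t.center_mem_openTile))
  refine ⟨?_, hnot, fun t ht s hs hsA => ?_⟩
  · obtain ⟨t, ht⟩ := exists_mem_hull x
    have htA : t ∉ A := fun htA => hx (hull_subset_region htA ht)
    refine ⟨t, key _ t.convex_openTile.isPreconnected
      (disjoint_openTile_region htA).subset_compl_right ?_⟩
    rw [Set.inter_comm]
    exact mem_closure_iff.1 (t.hull_subset_closure_openTile ht) _
      (isClosed_region A).isOpen_compl.connectedComponentIn (mem_connectedComponentIn hx)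
  · obtain ⟨W, hW, hsW, htW, hWd⟩ := exists_isPreconnected_of_mem_nbrs hs
    refine hsW.trans (key W hW ?_ ⟨_, htW t.center_mem_openTile, ht t.center_mem_openTile⟩)
    refine Set.disjoint_left.1 (Set.disjoint_iUnion₂_right.2 fun r hr => hWd r ?_ ?_)
    · rintro rfl; exact hsA hr
    · rintro rfl; exact hnot _ ht hr

/-- Filling in bounded components of the complement removes their boundaries. -/
theorem exists_fill (A : Finset Tile) (F : Finset (Set ℂ))
    (hF : ∀ C ∈ F, (∃ x ∈ (region A)ᶜ, C = connectedComponentIn (region A)ᶜ x) ∧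
      Bornology.IsBounded C) :
    ∃ T : Set ℂ → Finset Tile, (∀ C ∈ F, (T C).Nonempty) ∧
      ∃ B : Finset Tile, #B = #A + ∑ C ∈ F, #(T C) ∧ cut B + ∑ C ∈ F, cut (T C) = cut A := by
  classical
  have hT : ∀ C : Set ℂ, ∃ T : Finset Tile, C ∈ F → ∀ t, t ∈ T ↔ t.openTile ⊆ C := by
    intro C
    by_cases hC : C ∈ F
    · have hfin := finite_setOf_openTile_subset (hF C hC).2
      exact ⟨hfin.toFinset, fun _ t => by simp⟩
    · exact ⟨∅, fun h => absurd h hC⟩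
  choose T hT using hT
  refine ⟨T, fun C hC => ?_, A ∪ F.biUnion T, ?_⟩
  · obtain ⟨t, ht⟩ := (openTile_subset_component (hF C hC).1).1
    exact ⟨t, (hT C hC t).2 ht⟩
  induction F using Finset.induction_on with
  | empty => simp
  | insert C F hCF ih =>
    obtain ⟨ih1, ih2⟩ := ih (fun D hD => hF D (Finset.mem_insert_of_mem hD))
      fun D hD => hT D (Finset.mem_insert_of_mem hD)
    have hC := hF C (Finset.mem_insert_self C F)
    have hTC := hT C (Finset.mem_insert_self C F)
    obtain ⟨-, hnot, hclosed⟩ := openTile_subset_component hC.1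
    have hdis : Disjoint (A ∪ F.biUnion T) (T C) := by
      rw [Finset.disjoint_right]
      intro t ht htA
      rw [hTC] at ht
      obtain htA | htF := Finset.mem_union.1 htA
      · exact hnot t ht htA
      · obtain ⟨D, hD, htD⟩ := Finset.mem_biUnion.1 htF
        rw [hT D (Finset.mem_insert_of_mem hD)] at htD
        obtain ⟨⟨x, -, rfl⟩, -⟩ := hC
        obtain ⟨⟨y, -, rfl⟩, -⟩ := hF D (Finset.mem_insert_of_mem hD)
        rw [connectedComponentIn_eq (ht t.center_mem_openTile),
          ← connectedComponentIn_eq (htD t.center_mem_openTile)] at hCF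
        exact hCF hD
    have hcut := cut_union_of_closed hdis fun t ht s hs hsT =>
      Finset.mem_union_left _ (by_contra fun hsA =>
        hsT ((hTC s).2 (hclosed t ((hTC t).1 ht) s hs hsA)))
    have hset : A ∪ (Insert.insert C F).biUnion T = A ∪ F.biUnion T ∪ T C := by
      rw [Finset.biUnion_insert, Finset.union_comm (T C), Finset.union_assoc]
    rw [hset, Finset.card_union_of_disjoint hdis, Finset.sum_insert hCF, Finset.sum_insert hCF]
    omega

/-! ### The isoperimetric bound -/

/-- Connectedness does not matter for the least perimeter, since optimal sets are connected. -/
theorem pMin_eq_minCut {n : ℕ} (hn : 1 ≤ n) : pMin n = minCut n := by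
  refine IsLeast.csInf_eq ⟨?_, ?_⟩
  · obtain ⟨A, rfl, h⟩ := exists_cut_eq_minCut n
    exact ⟨A, isPolyiamond_of_cut_eq_minCut (Finset.card_pos.1 hn) h, rfl,
      (perimeter_eq_cut A).trans h⟩
  · rintro _ ⟨A, -, rfl, rfl⟩
    rw [perimeter_eq_cut]
    exact minCut_le A

/-- The holes of a polyiamond cost perimeter: each one-tile hole has perimeter three and each larger
hole at least four, and the excess of a single larger hole makes up for the failure of `minCut` to
be monotone. -/
theorem minCut_add_three_mul_le {A : Finset Tile} (hA : IsPolyiamond A) :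
    minCut (#A + holes A) + 3 * holes A ≤ #A + 2 := by
  obtain ⟨F, hF, hFc⟩ : ∃ F : Finset (Set ℂ),
      (∀ C ∈ F, (∃ x ∈ (region A)ᶜ, C = connectedComponentIn (region A)ᶜ x) ∧
        Bornology.IsBounded C) ∧ #F = holes A := by
    -- If the set of holes were infinite, then `holes A` would be zero.
    obtain h | h := Set.finite_or_infinite {C : Set ℂ |
      (∃ x ∈ (region A)ᶜ, C = connectedComponentIn (region A)ᶜ x) ∧ Bornology.IsBounded C}
    · exact ⟨h.toFinset, fun C hC => h.mem_toFinset.1 hC, (Set.ncard_eq_toFinset_card _ h).symm⟩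
    · exact ⟨∅, by simp, h.ncard.symm⟩
  obtain ⟨T, hT, B, hB, hcut⟩ := exists_fill A F hF
  have hle := hA.cut_le
  have hB' := minCut_le B
  rw [← hFc]
  by_cases h1 : ∀ C ∈ F, #(T C) = 1
  · rw [Finset.sum_congr rfl h1, ← Finset.card_eq_sum_ones] at hB
    have h3 := Finset.card_nsmul_le_sum F (fun C => cut (T C)) 3 fun C hC => three_le_cut (hT C hC)
    rw [smul_eq_mul] at h3
    rw [hB] at hB'
    omega
  · push Not at h1
    obtain ⟨C, hC, hC1⟩ := h1
    have hC2 : 2 ≤ #(T C) := by have := (hT C hC).card_pos; omega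
    have h3 : ∑ C ∈ F, 3 < ∑ C ∈ F, cut (T C) :=
      Finset.sum_lt_sum (fun C hC => three_le_cut (hT C hC))
        ⟨C, hC, (four_le_minCut hC2).trans (minCut_le _)⟩
    have h4 : ∑ C ∈ F, 1 ≤ ∑ C ∈ F, #(T C) :=
      Finset.sum_le_sum fun C hC => (hT C hC).card_pos
    rw [Finset.sum_const, smul_eq_mul] at h3
    rw [← Finset.card_eq_sum_ones] at h4
    have h5 := minCut_le_add_one_of_le (m := #A + #F) (n := #B)
      (by have := hA.nonempty.card_pos; omega) (by omega)
    omega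

theorem M_eq {n : ℕ} (hn : 1 ≤ n) (h : ℕ) : M n h = ((n : ℚ) + 2 - pMin (n + h)) / 3 := by
  have hb : (bMin n : ℚ) + 1 = n := by exact_mod_cast bMin_eq hn
  rw [M, ← hb]
  ring

theorem holes_le_M {A : Finset Tile} (hA : IsPolyiamond A) : (holes A : ℚ) ≤ M #A (holes A) := by
  have hn : 1 ≤ #A := hA.nonempty.card_pos
  have h := minCut_add_three_mul_le hA
  rw [← pMin_eq_minCut (by omega)] at h
  have h' : (pMin (#A + holes A) : ℚ) + 3 * holes A ≤ #A + 2 := by exact_mod_cast h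
  rw [M_eq hn]
  linarith

/-- One more tile can always be attached at the cost of at most one unit of perimeter. -/
theorem M_le_M_of_le {m n : ℕ} (hm : 1 ≤ m) (hmn : m ≤ n) (h : ℕ) : M m h ≤ M n h := by
  induction n, hmn using Nat.le_induction with
  | base => rfl
  | succ n hmn ih =>
    refine ih.trans ?_
    have h1 := minCut_succ_le (n := n + h) (by omega)
    rw [← pMin_eq_minCut (by omega), ← pMin_eq_minCut (by omega)] at h1
    have h2 : (pMin (n + h + 1) : ℚ) ≤ pMin (n + h) + 1 := by exact_mod_cast h1
    rw [M_eq (by omega), M_eq (by omega), add_right_comm n 1 h]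
    push_cast
    linarith

end Polyiamond

theorem lemma2p2 :
    -- the topological isoperimetric inequality
    (∀ (n h : ℕ),
      (∃ A : Finset Polyiamond.Tile,
        Polyiamond.IsPolyiamond A ∧ A.card = n ∧ Polyiamond.holes A = h) →
      (h : ℚ) ≤
        (3 * (n : ℚ) - 2 * (Polyiamond.bMin n : ℚ) - (Polyiamond.pMin (n + h) : ℚ)) / 3) ∧
    -- the second form of the bound
    (∀ (n h : ℕ), 1 ≤ n →
      (3 * (n : ℚ) - 2 * (Polyiamond.bMin n : ℚ) - (Polyiamond.pMin (n + h) : ℚ)) / 3 =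
        ((n : ℚ) + 2 - (Polyiamond.pMin (n + h) : ℚ)) / 3) ∧
    -- if `M n h < h`, then there is no polyiamond with `n` tiles and `h` holes
    (∀ (n h : ℕ), Polyiamond.M n h < (h : ℚ) →
      ¬ ∃ A : Finset Polyiamond.Tile,
        Polyiamond.IsPolyiamond A ∧ A.card = n ∧ Polyiamond.holes A = h) ∧
    -- if there is one, and `n` is the least tile number with `M n h = h`, then `gTri h = n`
    (∀ (n h : ℕ),
      (∃ A : Finset Polyiamond.Tile,
        Polyiamond.IsPolyiamond A ∧ A.card = n ∧ Polyiamond.holes A = h) →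
      IsLeast {m : ℕ | 1 ≤ m ∧ Polyiamond.M m h = (h : ℚ)} n →
      Polyiamond.gTri h = n) := by
  have bound : ∀ n h : ℕ, (∃ A : Finset Polyiamond.Tile,
      Polyiamond.IsPolyiamond A ∧ A.card = n ∧ Polyiamond.holes A = h) →
      (h : ℚ) ≤ Polyiamond.M n h := by
    rintro _ _ ⟨A, hA, rfl, rfl⟩
    exact Polyiamond.holes_le_M hA
  refine ⟨bound, fun n h hn => Polyiamond.M_eq hn h,
    fun n h hM hex => (bound n h hex).not_gt hM, ?_⟩
  rintro n h ⟨A, hA, hn, hh⟩ ⟨⟨-, hMn⟩, hmin⟩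
  refine IsLeast.csInf_eq ⟨⟨A, hA, hh, hn⟩, ?_⟩
  rintro m ⟨B, hB, hBh, hBm⟩
  by_contra! hlt
  have hm : 1 ≤ m := hBm ▸ hB.nonempty.card_pos
  -- `M` is monotone in the number of tiles, so `h ≤ M m h ≤ M n h = h`.
  refine hlt.not_ge (hmin ⟨hm, le_antisymm ?_ (bound m h ⟨B, hB, hBm, hBh⟩)⟩)
  exact hMn ▸ Polyiamond.M_le_M_of_le hm hlt.le h
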